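/- Work in the complex projective plane $\mathbb{CP}^2$ (real polygons are included as polygons with real coordinates). For a sequence of points $P=(p_i)_{i\in\mathbb Z/m}$ and a positive integer $a$ let $\vee_a(P)$ be the sequence of lines $(p_i\vee p_{i+a})_{i\in\mathbb Z/m}$ joining $p_i$ and $p_{i+a}$, and for a sequence of lines $L=(l_i)_{i\in\mathbb Z/m}$ and a positive integer $b$ let $\wedge_b(L)$ be the sequence of intersection points $(l_i\wedge l_{i-b})_{i\in\mathbb Z/m}$. A Poncelet $m$-gon ($m\ge 3$) is a sequence $P=(p_i)_{i\in\mathbb Z/m}$ of $m$ distinct points that all lie on one nondegenerate conic and whose side lines $p_i\vee p_{i+1}$ are all tangent to one nondegenerate conic. Let $P$ be a Poncelet $m$-gon and let $a,b,c,d$ be positive integers smaller than $m/2$. Then both composite operations below are well defined on $P$ (only distinct points are joined and only distinct lines are intersected) and $$(\wedge_d\vee_c)(\wedge_b\vee_a)(P)=(\wedge_b\vee_a)(\wedge_d\vee_c)(P)$$ as indexed sequences of points. As a consequence, the deeper-diagonal pentagram maps $T_k=\wedge_1\vee_k$ commute on Poncelet polygons: $T_sT_t(P)=T_tT_s(P)$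 for all positive integers $s,t<m/2$. -/

import Mathlib

open scoped LinearAlgebra.Projectivization Matrix

noncomputable section

/-- Points of the complex projective plane, given by homogeneous coordinates. -/
abbrev ProjPoint : Type := ℙ ℂ (Fin 3 → ℂ)

/-- Lines of the complex projective plane, given by homogeneous line coordinates: the point `p`
lies on the line `l` iff `p.orthogonal l`, i.e. iff the dot product of the coordinates is zero. -/
abbrev ProjLine : Type := ℙ ℂ (Fin 3 → ℂ)

/-- The line `p ∨ q` through two distinct points (the value at `p = q` is meaningless). -/
def joinPts (p q : ProjPoint) : ProjLine := Projectivization.cross p q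

/-- The common point `k ∧ l` of two distinct lines (the value at `k = l` is meaningless). -/
def meetLns (k l : ProjLine) : ProjPoint := Projectivization.cross k l

/-- A (nondegenerate) conic of the complex projective plane, given by an invertible symmetric
matrix. -/
structure ProjConic where
  /-- the matrix of the quadratic form -/
  mat : Matrix (Fin 3) (Fin 3) ℂ
  symm : mat.IsSymm
  det_ne_zero : mat.det ≠ 0

namespace ProjConic

theorem mulVec_inj (C : ProjConic) : Function.Injective (Matrix.toLin' C.mat) := by
  rw [Matrix.toLin'_apply']
  exact Matrix.mulVec_injective_of_isUnit
    ((Matrix.isUnit_iff_isUnit_det _).2 (isUnit_iff_ne_zero.2 C.det_ne_zero))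

/-- The polar line of a point `p`; it has line coordinates `A p`, where `A` is the matrix of the
conic. -/
def polar (C : ProjConic) (p : ProjPoint) : ProjLine :=
  Projectivization.map (Matrix.toLin' C.mat) C.mulVec_inj p

/-- The point `p` lies on the conic with matrix `A`: `pᵀ A p = 0`. -/
def HasPoint (C : ProjConic) (p : ProjPoint) : Prop :=
  p.orthogonal (C.polar p)

/-- The line `l` is tangent to the conic: it is the tangent (that is, the polar line) at some
point of the conic. -/
def HasTangent (C : ProjConic) (l : ProjLine) : Prop :=
  ∃ p : ProjPoint, C.HasPoint p ∧ l = C.polar p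

end ProjConic

/-- The ring of lines `∨_a (P) = (p_i ∨ p_{i+a})_i`, indices modulo `m`. -/
def joinRing {m : ℕ} (a : ℕ) (P : ZMod m → ProjPoint) : ZMod m → ProjLine :=
  fun i => joinPts (P i) (P (i + (a : ZMod m)))

/-- The ring of points `∧_b (L) = (l_i ∧ l_{i-b})_i`, indices modulo `m`. -/
def meetRing {m : ℕ} (b : ℕ) (L : ZMod m → ProjLine) : ZMod m → ProjPoint :=
  fun i => meetLns (L i) (L (i - (b : ZMod m)))

/-- The operation `∧_b ∨_a`. -/
def meetJoin {m : ℕ} (b a : ℕ) (P : ZMod m → ProjPoint) : ZMod m → ProjPoint :=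
  meetRing b (joinRing a P)

/-- All lines and points that are constructed in forming `(∧_b ∨_a)(P)` are well defined:
`∨_a` joins distinct points and `∧_b` intersects distinct lines. -/
def MeetJoinDefined {m : ℕ} (b a : ℕ) (P : ZMod m → ProjPoint) : Prop :=
  (∀ i, P i ≠ P (i + (a : ZMod m))) ∧
    ∀ i, joinRing a P i ≠ joinRing a P (i - (b : ZMod m))

/-- The deeper-diagonal pentagram map `T_k = ∧_1 ∨_k`. -/
def pentagramMap {m : ℕ} (k : ℕ) (P : ZMod m → ProjPoint) : ZMod m → ProjPoint :=
  meetJoin 1 k P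

/-- `P` is a Poncelet `m`-gon: `m ≥ 3` distinct points, all on one conic, such that all the side
lines `p_i ∨ p_{i+1}` (indices modulo `m`) are tangent to another conic. -/
def IsPonceletPolygon {m : ℕ} (P : ZMod m → ProjPoint) : Prop :=
  3 ≤ m ∧ Function.Injective P ∧
    ∃ C X : ProjConic, (∀ i, C.HasPoint (P i)) ∧ ∀ i, X.HasTangent (joinRing 1 P i)

end

/-! ### Vector algebra for the conic `x ⬝ᵥ x = 0` -/

section CrossProduct

/-! A projective transformation turns the circumscribed conic into `x ⬝ᵥ x = 0` and the inscribed
one into a symmetric matrix `S`. Over ℂ, `S` has a square root `T` in the commutative algebra ℂ[S].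
A side is tangent to `S` exactly when it is `T g` with `g` on the first conic, so interleaving the
vertices with these `g` gives a chain of points `h j` on one conic with `h j ⬝ᵥ T (h (j+1)) = 0` for
all `j`.

The main claim (`exists_isShiftConj`) is that for `0 < k < m/2` some invertible `a` in ℂ[S]
satisfies `h j ⬝ᵥ a (h (j+k)) = 0` for all `j`. Then the diagonal through `h (j-k)` and `h (j+k)` is
`a (h j)`. Joins and meets thus apply elements of ℂ[S] and shift the index (`meetJoin_isRep`), and
such operations commute.

The claim is proved by induction on `k`, through the group law of the cubic `y² = det (T² + x)`: an
`a` with `T² = a² + κ` gives the point `(-κ, det a)`, and passing to `k + 1` adds the point of `T`.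
Doubling is `isConj_two`; addition is `orthogonal_add` and `isConj_succ`. The degenerate cases are
excluded by incidence arguments (`const_ne_zero`, `det_ne_zero`). Everything else is polynomial
identities, so the two conics need not be in general position. -/

theorem exists_eq_smul_of_cross_eq_zero {x w : Fin 3 → ℂ} (hx : x ≠ 0) (h : x ⨯₃ w = 0) :
    ∃ t : ℂ, w = t • x := by
  by_contra hc
  push Not at hc
  exact crossProduct_ne_zero_iff_linearIndependent.2
    ((LinearIndependent.pair_iff' hx).2 fun t => (hc t).symm) h

theorem ne_zero_of_cross_left {x y : Fin 3 → ℂ} (h : x ⨯₃ y ≠ 0) : x ≠ 0 := by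
  rintro rfl; simp at h

theorem cross_ne_zero_symm {x y : Fin 3 → ℂ} (h : x ⨯₃ y ≠ 0) : y ⨯₃ x ≠ 0 := by
  rw [← cross_anticomm]; exact neg_ne_zero.2 h

/-- The cross product of two vectors orthogonal to `x ≠ 0` is a multiple of `x`. -/
theorem exists_cross_eq_smul {x u v : Fin 3 → ℂ} (hx : x ≠ 0) (hu : x ⬝ᵥ u = 0)
    (hv : x ⬝ᵥ v = 0) : ∃ t : ℂ, u ⨯₃ v = t • x := by
  refine exists_eq_smul_of_cross_eq_zero hx ?_
  rw [cross_cross_eq_smul_sub_smul', dotProduct_comm u x, hv, hu]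
  simp

/-- A vector orthogonal to two independent vectors is a multiple of their cross product. -/
theorem exists_eq_smul_cross {x y n : Fin 3 → ℂ} (h : x ⨯₃ y ≠ 0) (hx : x ⬝ᵥ n = 0)
    (hy : y ⬝ᵥ n = 0) : ∃ t : ℂ, n = t • x ⨯₃ y := by
  refine exists_eq_smul_of_cross_eq_zero h ?_
  rw [cross_cross_eq_smul_sub_smul, hx, hy]
  simp

theorem cross_dot_self_of_isotropic {u v : Fin 3 → ℂ} (hu : u ⬝ᵥ u = 0) :
    (u ⨯₃ v) ⬝ᵥ (u ⨯₃ v) = -(u ⬝ᵥ v) ^ 2 := by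
  rw [cross_dot_cross, hu, dotProduct_comm v u]; ring

/-- A nondegenerate conic contains no line: if `u ⬝ᵥ v = 0`, then `u` and `v` are both multiples of
`u ⨯₃ v`, hence parallel. -/
theorem dot_ne_zero_of_isotropic {u v : Fin 3 → ℂ} (hu : u ⬝ᵥ u = 0) (hv : v ⬝ᵥ v = 0)
    (h : u ⨯₃ v ≠ 0) : u ⬝ᵥ v ≠ 0 := by
  intro huv
  have h1 : (u ⨯₃ v) ⨯₃ u = 0 := by
    rw [cross_cross_eq_smul_sub_smul, dotProduct_comm v u, huv, hu]; simp
  have h2 : (u ⨯₃ v) ⨯₃ v = 0 := by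
    rw [cross_cross_eq_smul_sub_smul, huv, hv]; simp
  obtain ⟨s, hs⟩ := exists_eq_smul_of_cross_eq_zero h h1
  obtain ⟨t, ht⟩ := exists_eq_smul_of_cross_eq_zero h h2
  apply h
  have : u ⨯₃ v = (s • u ⨯₃ v) ⨯₃ (t • u ⨯₃ v) := by rw [← hs, ← ht]
  rw [this]
  simp

/-- A line meets a nondegenerate conic in at most two points. -/
theorem isotropic_of_orthogonal {u v w n : Fin 3 → ℂ} (hn : n ≠ 0) (hu : u ⬝ᵥ u = 0)
    (hv : v ⬝ᵥ v = 0) (hw : w ⬝ᵥ w = 0) (hnu : n ⬝ᵥ u = 0) (hnv : n ⬝ᵥ v = 0)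
    (hnw : n ⬝ᵥ w = 0) (huv : u ⨯₃ v ≠ 0) (huw : u ⨯₃ w ≠ 0) : v ⨯₃ w = 0 := by
  have hd := dot_ne_zero_of_isotropic hu hv huv
  obtain ⟨s, hs⟩ := exists_cross_eq_smul hn hnu hnv
  have hs0 : s ≠ 0 := by rintro rfl; exact huv (by simpa using hs)
  obtain ⟨t, ht⟩ := exists_cross_eq_smul hn hnu hnw
  obtain ⟨r, hr⟩ := exists_cross_eq_smul hn hnv hnw
  have ht0 : t ≠ 0 := by rintro rfl; exact huw (by simpa using ht)
  have e1 := cross_dot_self_of_isotropic (v := v) hu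
  have e2 := cross_dot_cross u v v w
  have e3 := cross_dot_cross u v u w
  have e4 := cross_dot_cross u w v w
  rw [hs] at e1
  rw [hs, hr, hv] at e2
  rw [hs, ht, hu, dotProduct_comm v u] at e3
  rw [ht, hr, hw, dotProduct_comm w v] at e4
  simp only [smul_dotProduct, dotProduct_smul, smul_eq_mul] at e1 e2 e3 e4
  have hnn : n ⬝ᵥ n ≠ 0 := by
    intro h0
    rw [h0] at e1
    exact pow_ne_zero 2 hd (by linear_combination e1)
  -- Grouping the product as `(st n·n)(sr n·n)` or as `(s² n·n)(tr n·n)` gives opposite values, so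
  -- it vanishes.
  have hz : s * s * t * (n ⬝ᵥ n) * (n ⬝ᵥ n) * r = 0 := by
    linear_combination (1 / 2) * (s * (t * (n ⬝ᵥ n)) * e2 + (u ⬝ᵥ v) * (v ⬝ᵥ w) * e3
      - (u ⬝ᵥ v) ^ 2 * e4 + (t * (r * (n ⬝ᵥ n))) * e1)
  have hr0 : r = 0 := by
    have := mul_ne_zero (mul_ne_zero (mul_ne_zero (mul_ne_zero hs0 hs0) ht0) hnn) hnn
    exact (mul_eq_zero.1 hz).resolve_left this
  rw [hr, hr0, zero_smul]

theorem transpose_mulVec_cross_mulVec (M : Matrix (Fin 3) (Fin 3) ℂ) (u v : Fin 3 → ℂ) :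
    Mᵀ *ᵥ ((M *ᵥ u) ⨯₃ (M *ᵥ v)) = M.det • u ⨯₃ v := by
  ext i
  fin_cases i <;>
    simp only [cross_apply, Matrix.mulVec, Matrix.vec3_dotProduct, Matrix.det_fin_three,
      Matrix.transpose_apply, Pi.smul_apply, smul_eq_mul, Matrix.cons_val] <;>
    simp <;> ring

/-- Expresses conjugacy of two points of the conic through the value of the form on their joining
line; this drives the doubling step. -/
theorem isotropic_pairing {P U : Fin 3 → ℂ} (M : Matrix (Fin 3) (Fin 3) ℂ) (hM : M.IsSymm)
    (hP : P ⬝ᵥ P = 0) (hU : U ⬝ᵥ U = 0) :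
    2 * (P ⬝ᵥ U) * (P ⬝ᵥ (M *ᵥ U))
      = M.trace * (P ⬝ᵥ U) ^ 2 + (P ⨯₃ U) ⬝ᵥ (M *ᵥ (P ⨯₃ U)) := by
  have h01 := hM.apply 0 1
  have h02 := hM.apply 0 2
  have h12 := hM.apply 1 2
  have general : 2 * (P ⬝ᵥ U) * (P ⬝ᵥ (M *ᵥ U)) = M.trace * (P ⬝ᵥ U) ^ 2
      + (P ⨯₃ U) ⬝ᵥ (M *ᵥ (P ⨯₃ U)) - M.trace * (P ⬝ᵥ P) * (U ⬝ᵥ U)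
      + (U ⬝ᵥ U) * (P ⬝ᵥ (M *ᵥ P)) + (P ⬝ᵥ P) * (U ⬝ᵥ (M *ᵥ U)) := by
    simp only [Matrix.trace_fin_three, cross_apply, Matrix.mulVec, Matrix.vec3_dotProduct,
      Matrix.cons_val, h01, h02, h12]
    ring
  rw [general, hP, hU]
  ring

/-- The coefficient of the linear term in the characteristic polynomial. -/
def Matrix.minorSum (M : Matrix (Fin 3) (Fin 3) ℂ) : ℂ :=
  M 0 0 * M 1 1 - M 0 1 * M 1 0 + (M 0 0 * M 2 2 - M 0 2 * M 2 0)
    + (M 1 1 * M 2 2 - M 1 2 * M 2 1)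

theorem cayley_hamilton_fin_three (M : Matrix (Fin 3) (Fin 3) ℂ) :
    M * M * M - M.trace • (M * M) + M.minorSum • M - M.det • (1 : Matrix (Fin 3) (Fin 3) ℂ)
      = 0 := by
  ext i j
  fin_cases i <;> fin_cases j <;>
    simp [Matrix.mul_apply, Fin.sum_univ_three, Matrix.minorSum, Matrix.det_fin_three,
      Matrix.trace_fin_three] <;> ring

theorem det_smul_add_smul_one (M : Matrix (Fin 3) (Fin 3) ℂ) (x y : ℂ) :
    (x • M + y • (1 : Matrix (Fin 3) (Fin 3) ℂ)).det
      = x ^ 3 * M.det + x ^ 2 * y * M.minorSum + x * y ^ 2 * M.trace + y ^ 3 := by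
  simp [Matrix.minorSum, Matrix.det_fin_three, Matrix.trace_fin_three]
  ring

end CrossProduct

/-! ### A commutative algebra of symmetric matrices and the group law on its cubic -/

section CommutingFamily

variable {A : Type*} [CommRing A] [Algebra ℂ A] {φ : A →ₐ[ℂ] Matrix (Fin 3) (Fin 3) ℂ}

theorem act_mul (f g : A) (x : Fin 3 → ℂ) : φ f *ᵥ (φ g *ᵥ x) = φ (f * g) *ᵥ x := by
  rw [map_mul, Matrix.mulVec_mulVec]

theorem act_algebraMap (z : ℂ) (x : Fin 3 → ℂ) : φ (algebraMap ℂ A z) *ᵥ x = z • x := by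
  rw [AlgHom.commutes, Algebra.algebraMap_eq_smul_one, Matrix.smul_mulVec, Matrix.one_mulVec]

theorem dot_act (hs : ∀ f, (φ f).IsSymm) (f : A) (x y : Fin 3 → ℂ) :
    (φ f *ᵥ x) ⬝ᵥ y = x ⬝ᵥ (φ f *ᵥ y) := by
  rw [Matrix.dotProduct_mulVec, ← Matrix.mulVec_transpose, (hs f).eq]

theorem dot_act_comm (hs : ∀ f, (φ f).IsSymm) (f : A) (x y : Fin 3 → ℂ) :
    x ⬝ᵥ (φ f *ᵥ y) = y ⬝ᵥ (φ f *ᵥ x) := by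
  rw [← dot_act hs, dotProduct_comm]

theorem act_cross_act (hs : ∀ f, (φ f).IsSymm) (f : A) (x y : Fin 3 → ℂ) :
    φ f *ᵥ ((φ f *ᵥ x) ⨯₃ (φ f *ᵥ y)) = (φ f).det • x ⨯₃ y := by
  have := transpose_mulVec_cross_mulVec (φ f) x y
  rwa [(hs f).eq] at this

theorem act_ne_zero {f : A} (hf : (φ f).det ≠ 0) {x : Fin 3 → ℂ} (hx : x ≠ 0) :
    φ f *ᵥ x ≠ 0 := fun h => hf (Matrix.exists_mulVec_eq_zero_iff.1 ⟨x, hx, h⟩)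

theorem cayley_hamilton_act (hi : Function.Injective φ) (a : A) :
    a ^ 3 - algebraMap ℂ A (φ a).trace * a ^ 2 + algebraMap ℂ A (φ a).minorSum * a
      - algebraMap ℂ A (φ a).det = 0 := by
  apply hi
  have := cayley_hamilton_fin_three (φ a)
  simp only [map_sub, map_add, map_smul, map_one, map_pow, map_zero,
    Algebra.algebraMap_eq_smul_one, smul_mul_assoc, one_mul]
  rw [← this, pow_succ, pow_two]

/-- Cayley–Hamilton writes the adjugate as a polynomial in `a`, so the inverse stays inside the
commutative algebra. -/
theorem exists_mul_eq_one (hi : Function.Injective φ) {a : A} (ha : (φ a).det ≠ 0) :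
    ∃ a' : A, a * a' = 1 := by
  refine ⟨algebraMap ℂ A (φ a).det⁻¹ * (a ^ 2 - algebraMap ℂ A (φ a).trace * a
    + algebraMap ℂ A (φ a).minorSum), ?_⟩
  have h1 : algebraMap ℂ A (φ a).det⁻¹ * algebraMap ℂ A (φ a).det = 1 := by
    rw [← map_mul, inv_mul_cancel₀ ha, map_one]
  linear_combination (algebraMap ℂ A (φ a).det⁻¹) * cayley_hamilton_act hi a + h1

theorem det_act_linear (a : A) (x y : ℂ) :
    (φ (algebraMap ℂ A x * a + algebraMap ℂ A y)).det
      = x ^ 3 * (φ a).det + x ^ 2 * y * (φ a).minorSum + x * y ^ 2 * (φ a).trace + y ^ 3 := by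
  rw [← det_smul_add_smul_one]
  simp only [map_add, map_smul, map_one, Algebra.algebraMap_eq_smul_one, smul_mul_assoc, one_mul]

/-- The chord-tangent construction: `m` is the slope of the line through the points with
abscissae `0`, `κ` and ordinates `det a`, `det b` of the cubic `y² = det (a² + x)`, and `n` is the
abscissa of the third intersection point. -/
theorem exists_third_point (hi : Function.Injective φ) {a b : A} {κ m n : ℂ}
    (ha : (φ a).det ≠ 0) (hb : (φ b).det ≠ 0) (hab : b ^ 2 = a ^ 2 + algebraMap ℂ A κ)
    (hE : (φ b).det = (φ a).det + m * κ) (htr : (φ (a ^ 2)).trace = m ^ 2 - κ - n)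
    (hms : (φ (a ^ 2)).minorSum = 2 * (φ a).det * m + κ * n) :
    ∃ c : A, a * b * c = algebraMap ℂ A m * a ^ 2 - algebraMap ℂ A (φ a).det ∧
      c ^ 2 = a ^ 2 + algebraMap ℂ A n ∧
      algebraMap ℂ A (φ b).det * c ^ 2 + algebraMap ℂ A (φ c).det * b ^ 2
        = algebraMap ℂ A (κ - n) * (a * b * c) := by
  obtain ⟨a', ha'⟩ := exists_mul_eq_one hi ha
  obtain ⟨b', hb'⟩ := exists_mul_eq_one hi hb
  have hdet : (φ (a ^ 2)).det = (φ a).det ^ 2 := by rw [map_pow, Matrix.det_pow]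
  have hch := cayley_hamilton_act hi (a ^ 2)
  rw [htr, hms, hdet] at hch
  set D := (φ a).det with hD
  set E := (φ b).det with hEdef
  obtain ⟨c, hc⟩ : ∃ c : A, a * b * c = algebraMap ℂ A m * a ^ 2 - algebraMap ℂ A D :=
    ⟨a' * b' * (algebraMap ℂ A m * a ^ 2 - algebraMap ℂ A D), by
      linear_combination (algebraMap ℂ A m * a ^ 2 - algebraMap ℂ A D) * (b * b' * ha' + hb')⟩
  have hc2 : c ^ 2 = a ^ 2 + algebraMap ℂ A n := by
    -- The conditions on trace and minor sum say `det (a² + x) - (D + m x)² = x (x - κ) (x - n)`;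
    -- Cayley–Hamilton is the substitution `x = -a²`.
    have h1 : (a * b * c) ^ 2 = a ^ 2 * b ^ 2 * (a ^ 2 + algebraMap ℂ A n) := by
      rw [hc, hab]
      simp only [map_sub, map_add, map_mul, map_pow, map_ofNat] at hch
      linear_combination -hch
    have h2 : (a * b) * (a' * b') = 1 := by linear_combination b * b' * ha' + hb'
    have h3 : ((a * b) * (a' * b')) ^ 2 * c ^ 2
        = ((a * b) * (a' * b')) ^ 2 * (a ^ 2 + algebraMap ℂ A n) := by
      linear_combination (a' * b') ^ 2 * h1
    rwa [h2, one_pow, one_mul, one_mul] at h3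
  -- The chord has ordinate `D + m n` at `n`. The element `c` carries its negative, hence represents
  -- the sum and not the third intersection point.
  have hF : (φ c).det = -(D + m * n) := by
    have h1 : D * E * (φ c).det = -(D * E * (D + m * n)) := by
      have h2 := det_act_linear (φ := φ) (a ^ 2) m (-D)
      rw [map_neg, ← sub_eq_add_neg, ← hc, map_mul, map_mul, Matrix.det_mul, Matrix.det_mul,
        htr, hms, hdet, ← hD, ← hEdef] at h2
      rw [h2, hE]; ring
    exact mul_left_cancel₀ (mul_ne_zero ha hb) (by rw [h1]; ring)
  refine ⟨c, hc, hc2, ?_⟩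
  rw [hc, hF, hc2, hab, hE]
  simp only [map_sub, map_add, map_mul, map_neg]
  ring

/-- The trace condition defines `n`; the minor sum condition is then the equation of the cubic at
`κ`, divided by `κ`. -/
theorem exists_slope {a b : A} {κ : ℂ} (hab : b ^ 2 = a ^ 2 + algebraMap ℂ A κ) (hκ : κ ≠ 0) :
    ∃ m n : ℂ, (φ b).det = (φ a).det + m * κ ∧ (φ (a ^ 2)).trace = m ^ 2 - κ - n ∧
      (φ (a ^ 2)).minorSum = 2 * (φ a).det * m + κ * n := by
  set D := (φ a).det with hD
  set E := (φ b).det with hE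
  have h : E ^ 2 = D ^ 2 + κ * (φ (a ^ 2)).minorSum + κ ^ 2 * (φ (a ^ 2)).trace + κ ^ 3 := by
    have h1 := det_act_linear (φ := φ) (a ^ 2) 1 κ
    rw [map_one, one_mul, ← hab, map_pow, Matrix.det_pow, ← hE] at h1
    rw [h1, map_pow, Matrix.det_pow, ← hD]; ring
  have hm : (E - D) / κ * κ = E - D := div_mul_cancel₀ _ hκ
  refine ⟨(E - D) / κ, ((E - D) / κ) ^ 2 - κ - (φ (a ^ 2)).trace, ?_, by ring, ?_⟩
  · rw [hm]; ring
  · set m := (E - D) / κ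
    have hE' : E = D + m * κ := by rw [hm]; ring
    rw [hE'] at h
    exact mul_left_cancel₀ hκ (by linear_combination -h)

/-- Addition of parameters. -/
theorem orthogonal_add (hi : Function.Injective φ) (hs : ∀ f, (φ f).IsSymm) {a b a₀ c : A}
    {κ m t : ℂ} (ha : (φ a).det ≠ 0) (hb : (φ b).det ≠ 0)
    (hab : b ^ 2 = a ^ 2 + algebraMap ℂ A κ) (hκ : κ ≠ 0)
    (hE : (φ b).det = (φ a).det + m * κ)
    (hc : a * b * c = algebraMap ℂ A m * a ^ 2 - algebraMap ℂ A (φ a).det)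
    (ht : algebraMap ℂ A (φ b).det * a ^ 2 + algebraMap ℂ A (φ a).det * b ^ 2
      = algebraMap ℂ A t * (a * b * a₀))
    {Q R : Fin 3 → ℂ} (hQ : Q ⬝ᵥ Q = 0) (hR : R ⬝ᵥ R = 0) (hQR : Q ⬝ᵥ (φ a₀ *ᵥ R) = 0)
    (hP : ((φ b *ᵥ Q) ⨯₃ (φ a *ᵥ R)) ⬝ᵥ ((φ b *ᵥ Q) ⨯₃ (φ a *ᵥ R)) = 0) :
    ((φ b *ᵥ Q) ⨯₃ (φ a *ᵥ R)) ⬝ᵥ (φ c *ᵥ ((φ b *ᵥ R) ⨯₃ (φ a *ᵥ Q))) = 0 := by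
  obtain ⟨a', ha'⟩ := exists_mul_eq_one hi ha
  obtain ⟨b', hb'⟩ := exists_mul_eq_one hi hb
  -- With `Q = a q` and `R = b r`, both factors of `P` are images under `ab`, so `ab P` is a
  -- multiple of `q ⨯₃ r`.
  obtain ⟨q, hq⟩ : ∃ q, q = φ a' *ᵥ Q := ⟨_, rfl⟩
  obtain ⟨r, hr⟩ : ∃ r, r = φ b' *ᵥ R := ⟨_, rfl⟩
  have hQq : Q = φ a *ᵥ q := by rw [hq, act_mul, ha', map_one, Matrix.one_mulVec]
  have hRr : R = φ b *ᵥ r := by rw [hr, act_mul, hb', map_one, Matrix.one_mulVec]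
  clear hq hr
  subst hQq hRr
  set D := (φ a).det with hD
  set E := (φ b).det with hEdef
  simp only [act_mul, dot_act hs] at hQ hR hQR
  obtain ⟨P, hPdef⟩ : ∃ P, P = (φ b *ᵥ (φ a *ᵥ q)) ⨯₃ (φ a *ᵥ (φ b *ᵥ r)) := ⟨_, rfl⟩
  obtain ⟨U, hUdef⟩ : ∃ U, U = (φ b *ᵥ (φ b *ᵥ r)) ⨯₃ (φ a *ᵥ (φ a *ᵥ q)) := ⟨_, rfl⟩
  rw [← hPdef] at hP
  rw [← hPdef, ← hUdef]
  rw [act_mul, act_mul] at hPdef hUdef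
  rw [mul_comm b a] at hPdef
  have hW : φ (a * b) *ᵥ P = (D * E) • q ⨯₃ r := by
    rw [hPdef, act_cross_act hs, map_mul, Matrix.det_mul]
  have hV1 : φ (b' * b') *ᵥ U
      = (E ^ 2)⁻¹ • (φ (b ^ 4) *ᵥ r) ⨯₃ (φ (a ^ 2 * b ^ 2) *ᵥ q) := by
    have h1 := act_cross_act hs (b * b) (φ (b * b) *ᵥ r) (φ (a * a) *ᵥ q)
    rw [← hUdef, map_mul φ b b, Matrix.det_mul, ← map_mul, ← hEdef, act_mul, act_mul] at h1
    have h2 := congrArg (φ (b' * b') *ᵥ ·) h1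
    simp only [Matrix.mulVec_smul, act_mul] at h2
    rw [show b' * b' * (b * b) = 1 by linear_combination (b * b' + 1) * hb', map_one,
      Matrix.one_mulVec] at h2
    rw [show b ^ 4 = b * b * (b * b) by ring, show a ^ 2 * b ^ 2 = b * b * (a * a) by ring, h2,
      smul_smul, ← pow_two E, inv_mul_cancel₀ (pow_ne_zero 2 hb), one_smul]
  have hV2 : φ (a' * a') *ᵥ U
      = (D ^ 2)⁻¹ • (φ (a ^ 2 * b ^ 2) *ᵥ r) ⨯₃ (φ (a ^ 4) *ᵥ q) := by
    have h1 := act_cross_act hs (a * a) (φ (b * b) *ᵥ r) (φ (a * a) *ᵥ q)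
    rw [← hUdef, map_mul φ a a, Matrix.det_mul, ← map_mul, ← hD, act_mul, act_mul] at h1
    have h2 := congrArg (φ (a' * a') *ᵥ ·) h1
    simp only [Matrix.mulVec_smul, act_mul] at h2
    rw [show a' * a' * (a * a) = 1 by linear_combination (a * a' + 1) * ha', map_one,
      Matrix.one_mulVec] at h2
    rw [show a ^ 4 = a * a * (a * a) by ring, show a ^ 2 * b ^ 2 = a * a * (b * b) by ring, h2,
      smul_smul, ← pow_two D, inv_mul_cancel₀ (pow_ne_zero 2 ha), one_smul]
  -- Splitting `κ c / (ab)` as `E b⁻² - D a⁻²` leaves only even powers of `a` and `b` in the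
  -- pairing.
  have hk : algebraMap ℂ A κ * (a' * b' * c)
      = algebraMap ℂ A E * (b' * b') - algebraMap ℂ A D * (a' * a') := by
    have e1 : algebraMap ℂ A E = algebraMap ℂ A D + algebraMap ℂ A m * algebraMap ℂ A κ := by
      rw [hE, map_add, map_mul]
    have e2 : algebraMap ℂ A κ * (a * b * c)
        = algebraMap ℂ A E * a ^ 2 - algebraMap ℂ A D * b ^ 2 := by
      rw [hc, hab, e1]; ring
    have e3 : a' * b' * c = (a' * b') ^ 2 * (a * b * c) := by
      linear_combination (-a' * b' * c) * (b * b' * ha' + hb')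
    rw [e3]
    linear_combination (a' * b') ^ 2 * e2 + algebraMap ℂ A E * b' ^ 2 * (a * a' + 1) * ha'
      - algebraMap ℂ A D * a' ^ 2 * (b * b' + 1) * hb'
  have hPU : κ * (P ⬝ᵥ (φ c *ᵥ U)) = D * E * (E * ((q ⨯₃ r) ⬝ᵥ (φ (b' * b') *ᵥ U))
      - D * ((q ⨯₃ r) ⬝ᵥ (φ (a' * a') *ᵥ U))) := by
    have e1 : c = a * b * (a' * b' * c) := by
      linear_combination (-c) * (b * b' * ha' + hb')
    have e2 : P ⬝ᵥ (φ c *ᵥ U) = (D * E) * ((q ⨯₃ r) ⬝ᵥ (φ (a' * b' * c) *ᵥ U)) := by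
      conv_lhs => rw [e1]
      rw [← act_mul, ← dot_act hs, hW, smul_dotProduct, smul_eq_mul]
    have e3 := congrArg (fun f => (q ⨯₃ r) ⬝ᵥ (φ f *ᵥ U)) hk
    simp only [map_sub, Matrix.sub_mulVec, ← act_mul (algebraMap ℂ A _), act_algebraMap,
      dotProduct_sub, dotProduct_smul, smul_eq_mul] at e3
    rw [e2]
    linear_combination D * E * e3
  rw [hV1, hV2, dotProduct_smul, dotProduct_smul, cross_dot_cross, cross_dot_cross] at hPU
  rw [hPdef, cross_dot_cross] at hP
  simp only [smul_eq_mul, dot_act hs, act_mul] at hPU hP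
  have hb4 : b ^ 4 = a ^ 2 * b ^ 2 + algebraMap ℂ A κ * (b * b) := by
    linear_combination b ^ 2 * hab
  have ha4 : a ^ 4 = a ^ 2 * b ^ 2 - algebraMap ℂ A κ * (a * a) := by
    linear_combination -a ^ 2 * hab
  -- Conjugacy under `a₀` becomes a linear relation, to which the pairing reduces once `P` is known
  -- to be isotropic.
  have hlin : E * (q ⬝ᵥ (φ (a * a) *ᵥ r)) + D * (q ⬝ᵥ (φ (b * b) *ᵥ r)) = 0 := by
    have e3 := congrArg (fun f => q ⬝ᵥ (φ f *ᵥ r)) ht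
    simp only [map_add, Matrix.add_mulVec, ← act_mul (algebraMap ℂ A _), act_algebraMap,
      dotProduct_add, dotProduct_smul, smul_eq_mul, pow_two] at e3
    rw [e3, show a * b * a₀ = a * (a₀ * b) by ring, hQR, mul_zero]
  rw [hb4, ha4] at hPU
  simp only [map_add, map_sub, Matrix.add_mulVec, Matrix.sub_mulVec,
    ← act_mul (algebraMap ℂ A _), act_algebraMap, dotProduct_add, dotProduct_sub,
    dotProduct_smul, smul_eq_mul, hQ, hR] at hPU
  rw [show a * b * (a * b) = a ^ 2 * b ^ 2 by ring] at hP
  rw [dot_act_comm hs _ r q] at hPU hP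
  refine (mul_eq_zero.1 (hPU.trans ?_)).resolve_left hκ
  rw [dot_act_comm hs _ r q]
  field_simp
  linear_combination (E - D) * hP + κ * (q ⬝ᵥ (φ (a ^ 2 * b ^ 2) *ᵥ r)) * hlin

end CommutingFamily

/-- Two lines, the first through the points `x`, `y` of a conic and the second through a third
point `z` of the conic, are distinct. -/
theorem cross_ne_zero_of_isotropic {x y z n₁ n₂ : Fin 3 → ℂ} (h₁ : n₁ ≠ 0) (h₂ : n₂ ≠ 0)
    (hx : x ⬝ᵥ x = 0) (hy : y ⬝ᵥ y = 0) (hz : z ⬝ᵥ z = 0) (hxn : x ⬝ᵥ n₁ = 0)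
    (hyn : y ⬝ᵥ n₁ = 0) (hzn : z ⬝ᵥ n₂ = 0) (hxy : x ⨯₃ y ≠ 0) (hxz : x ⨯₃ z ≠ 0)
    (hyz : y ⨯₃ z ≠ 0) : n₁ ⨯₃ n₂ ≠ 0 := by
  intro h
  obtain ⟨t, rfl⟩ := exists_eq_smul_of_cross_eq_zero h₁ h
  have ht : t ≠ 0 := by rintro rfl; simp at h₂
  rw [dotProduct_smul, smul_eq_mul] at hzn
  have hzn' := (mul_eq_zero.1 hzn).resolve_left ht
  rw [dotProduct_comm] at hxn hyn hzn'
  exact hyz (isotropic_of_orthogonal h₁ hx hy hz hxn hyn hzn' hxy hxz)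

theorem trace_mul_self (M : Matrix (Fin 3) (Fin 3) ℂ) :
    (M * M).trace = M.trace ^ 2 - 2 * M.minorSum := by
  simp only [Matrix.trace_fin_three, Matrix.mul_apply, Fin.sum_univ_three, Matrix.minorSum]
  ring

/-! ### Poncelet chains: nondegeneracy, doubling and addition -/

section Chain

variable {A : Type*} [CommRing A] [Algebra ℂ A] {φ : A →ₐ[ℂ] Matrix (Fin 3) (Fin 3) ℂ}

/-- The points `h i` and `h (i + k)` are conjugate with respect to the form `φ a`. -/
def IsShiftConj (φ : A →ₐ[ℂ] Matrix (Fin 3) (Fin 3) ℂ) (h : ℤ → Fin 3 → ℂ) (k : ℤ) (a : A) : Prop :=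
  ∀ i, h i ⬝ᵥ (φ a *ᵥ h (i + k)) = 0

/-- A Poncelet polygon on the conic `x ⬝ᵥ x = 0`, refined by half-integer indices: the even terms
of `h` are the vertices, the odd terms correspond to the sides. -/
structure IsPonceletChain (φ : A →ₐ[ℂ] Matrix (Fin 3) (Fin 3) ℂ) (m : ℕ) (b : A) (h : ℤ → Fin 3 → ℂ) :
    Prop where
  inj : Function.Injective φ
  symm : ∀ f, (φ f).IsSymm
  three_le : 3 ≤ m
  isotropic : ∀ i, h i ⬝ᵥ h i = 0
  cross : ∀ i k : ℤ, 0 < k → k < m → h i ⨯₃ h (i + 2 * k) ≠ 0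
  det : (φ b).det ≠ 0
  conj : IsShiftConj φ h 1 b

theorem IsShiftConj.apply {h : ℤ → Fin 3 → ℂ} {k : ℤ} {a : A} (H : IsShiftConj φ h k a)
    (hs : ∀ f, (φ f).IsSymm) {i j : ℤ} (hij : j = i + k ∨ i = j + k) :
    h i ⬝ᵥ (φ a *ᵥ h j) = 0 := by
  rcases hij with rfl | rfl
  · exact H i
  · rw [dot_act_comm hs]; exact H j

namespace IsPonceletChain

variable {m : ℕ} {b : A} {h : ℤ → Fin 3 → ℂ}

theorem cross_ne (H : IsPonceletChain φ m b h) (k : ℤ) {i j : ℤ} (hj : j = i + 2 * k) (hk : k ≠ 0)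
    (h1 : k < m) (h2 : -k < m) : h i ⨯₃ h j ≠ 0 := by
  rcases lt_or_gt_of_ne hk with hk | hk
  · have := H.cross j (-k) (by omega) (by omega)
    rw [show j + 2 * -k = i by omega] at this
    exact cross_ne_zero_symm this
  · subst hj; exact H.cross i k hk h1

theorem ne_zero (H : IsPonceletChain φ m b h) (i : ℤ) : h i ≠ 0 :=
  ne_zero_of_cross_left (H.cross i 1 one_pos (by have := H.three_le; omega))

/-- The line `b (h i)` is a secant of the conic, through `h (i-1)` and `h (i+1)`, hence not
isotropic. -/
theorem norm_ne_zero (H : IsPonceletChain φ m b h) (i : ℤ) : h i ⬝ᵥ (φ (b ^ 2) *ᵥ h i) ≠ 0 := by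
  have hm := H.three_le
  have hx : h (i - 1) ⨯₃ h (i + 1) ≠ 0 :=
    H.cross_ne 1 (by ring) one_ne_zero (by omega) (by omega)
  obtain ⟨t, ht⟩ := exists_eq_smul_cross (n := φ b *ᵥ h i) hx
    (H.conj.apply H.symm (by omega)) (H.conj.apply H.symm (by omega))
  have hn := act_ne_zero H.det (H.ne_zero i)
  have ht0 : t ≠ 0 := by rintro rfl; simp [ht] at hn
  have hd := dot_ne_zero_of_isotropic (H.isotropic _) (H.isotropic _) hx
  rw [pow_two, ← act_mul, ← dot_act H.symm, ht, smul_dotProduct, dotProduct_smul,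
    cross_dot_self_of_isotropic (H.isotropic _)]
  simp [ht0, hd]

/-- If `a² = b²`, then `b⁻¹ a (h k)` lies on the conic and on the secant `b (h 0)` through `h 1` and
`h (-1)`. It is neither of these points, because the lines `a (h k)` and `b (h (±1))` differ; a
secant has no third point. -/
theorem const_ne_zero (H : IsPonceletChain φ m b h) {a : A} {k : ℤ} {κ : ℂ} (hk : 2 ≤ k)
    (hkm : 2 * k < m) (ha : (φ a).det ≠ 0) (hconj : IsShiftConj φ h k a)
    (hab : b ^ 2 = a ^ 2 + algebraMap ℂ A κ) : κ ≠ 0 := by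
  rintro rfl
  rw [map_zero, add_zero] at hab
  obtain ⟨b', hb'⟩ := exists_mul_eq_one H.inj H.det
  have hw0 : φ (b' * a) *ᵥ h k ≠ 0 := by
    intro h0
    refine act_ne_zero ha (H.ne_zero k) ?_
    rw [show a = b * (b' * a) by linear_combination -a * hb', ← act_mul, h0, Matrix.mulVec_zero]
  have hpar : ∀ j : ℤ, (j = 1 ∨ j = -1) → h j ⨯₃ (φ (b' * a) *ᵥ h k) ≠ 0 := by
    intro j hj h0
    obtain ⟨t, ht⟩ := exists_eq_smul_of_cross_eq_zero (H.ne_zero j) h0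
    have hne : (φ b *ᵥ h j) ⨯₃ (φ a *ᵥ h k) ≠ 0 := by
      refine cross_ne_zero_of_isotropic (x := h 0) (y := h (2 * j)) (z := h (2 * k))
        (act_ne_zero H.det (H.ne_zero _)) (act_ne_zero ha (H.ne_zero _)) (H.isotropic _)
        (H.isotropic _) (H.isotropic _) (H.conj.apply H.symm (by omega))
        (H.conj.apply H.symm (by omega)) (hconj.apply H.symm (by omega))
        (H.cross_ne j (by omega) (by omega) (by omega) (by omega))
        (H.cross_ne k (by omega) (by omega) (by omega) (by omega))
        (H.cross_ne (k - j) (by omega) (by omega) (by omega) (by omega))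
    apply hne
    rw [show a = b * (b' * a) by linear_combination -a * hb', ← act_mul, ht, Matrix.mulVec_smul]
    simp
  refine hpar (-1) (Or.inr rfl) (isotropic_of_orthogonal (u := h 1)
    (act_ne_zero H.det (H.ne_zero 0))
    (H.isotropic _) (H.isotropic _) ?_ ?_ ?_ ?_
    (H.cross_ne (-1) (by omega) (by omega) (by omega) (by omega)) (hpar 1 (Or.inl rfl)))
  · rw [dot_act H.symm, act_mul, show b' * a * (b' * a) = b' ^ 2 * a ^ 2 by ring, ← hab,
      show b' ^ 2 * b ^ 2 = 1 by linear_combination (b * b' + 1) * hb', map_one,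
      Matrix.one_mulVec, H.isotropic]
  · rw [dot_act H.symm]; exact H.conj.apply H.symm (by omega)
  · rw [dot_act H.symm]; exact H.conj.apply H.symm (by omega)
  · rw [dot_act H.symm, act_mul, show b * (b' * a) = a by linear_combination a * hb']
    exact hconj.apply H.symm (by omega)

/-- If `c` kills `w`, every line `c (h i)` passes through `w`. Then `c (h 0)` and `c (h (-2k))`,
which share `h (-k)` as well, coincide and contain three points of the conic. -/
theorem det_ne_zero (H : IsPonceletChain φ m b h) {c : A} {k : ℤ} {n : ℂ} (hk : 0 < k)
    (hkm : 2 * k < m) (hconj : IsShiftConj φ h k c)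
    (hbc : c ^ 2 = b ^ 2 + algebraMap ℂ A n) : (φ c).det ≠ 0 := by
  intro hdet
  obtain ⟨w, hw, hcw⟩ := Matrix.exists_mulVec_eq_zero_iff.2 hdet
  have hc : ∀ i, φ c *ᵥ h i ≠ 0 := by
    intro i h0
    refine H.norm_ne_zero i ?_
    have h1 : h i ⬝ᵥ (φ (c ^ 2) *ᵥ h i) = 0 := by
      rw [pow_two, ← act_mul, h0, Matrix.mulVec_zero, dotProduct_zero]
    rwa [hbc, map_add, Matrix.add_mulVec, act_algebraMap, dotProduct_add, dotProduct_smul,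
      H.isotropic, smul_zero, add_zero] at h1
  have hwc : ∀ x, w ⬝ᵥ (φ c *ᵥ x) = 0 := fun x => by
    rw [← dot_act H.symm, hcw, zero_dotProduct]
  have hwx : w ⨯₃ h (-k) ≠ 0 := by
    intro h0
    obtain ⟨t, ht⟩ := exists_eq_smul_of_cross_eq_zero hw h0
    exact hc (-k) (by rw [ht, Matrix.mulVec_smul, hcw, smul_zero])
  obtain ⟨s, hs⟩ := exists_eq_smul_cross hwx (hwc (h 0)) (hconj.apply H.symm (by omega))
  obtain ⟨t, ht⟩ := exists_eq_smul_cross hwx (hwc (h (-2 * k))) (hconj.apply H.symm (by omega))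
  refine cross_ne_zero_of_isotropic (x := h (-k)) (y := h k) (z := h (-3 * k)) (hc 0)
    (hc (-2 * k)) (H.isotropic _) (H.isotropic _) (H.isotropic _)
    (hconj.apply H.symm (by omega)) (hconj.apply H.symm (by omega))
    (hconj.apply H.symm (by omega))
    (H.cross_ne k (by omega) (by omega) (by omega) (by omega))
    (H.cross_ne (-k) (by omega) (by omega) (by omega) (by omega))
    (H.cross_ne (-2 * k) (by omega) (by omega) (by omega) (by omega)) ?_
  rw [hs, ht]
  simp

/-- Tangent case of the addition. The line through `h i` and `h (i+2)` is `b (h (i+1))`, on which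
the form `c` equals `s` times the standard form; as `trace c = s`, the two terms of
`isotropic_pairing` cancel. -/
theorem isConj_two (H : IsPonceletChain φ m b h) {c : A} {s : ℂ} (hbc : b * b * c
      = algebraMap ℂ A s * b ^ 2 - algebraMap ℂ A (φ b).det)
    (hms : (φ (b ^ 2)).minorSum = 2 * (φ b).det * s) : IsShiftConj φ h 2 c := by
  intro i
  have hm := H.three_le
  have hx : h i ⨯₃ h (i + 2) ≠ 0 := H.cross_ne 1 (by ring) one_ne_zero (by omega) (by omega)
  obtain ⟨t, ht⟩ := exists_eq_smul_cross (n := φ b *ᵥ h (i + 1)) hx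
    (H.conj.apply H.symm (by omega)) (H.conj.apply H.symm (by omega))
  have hn := act_ne_zero H.det (H.ne_zero (i + 1))
  have ht0 : t ≠ 0 := by rintro rfl; simp [ht] at hn
  have hd := dot_ne_zero_of_isotropic (H.isotropic _) (H.isotropic _) hx
  have hdd := cross_dot_self_of_isotropic (v := h (i + 2)) (H.isotropic i)
  have hpair := isotropic_pairing (φ c) (H.symm c) (H.isotropic i) (H.isotropic (i + 2))
  have hxx : t ^ 2 * (h i ⨯₃ h (i + 2) ⬝ᵥ (h i ⨯₃ h (i + 2)))
      = h (i + 1) ⬝ᵥ (φ (b ^ 2) *ᵥ h (i + 1)) := by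
    rw [pow_two b, ← act_mul, ← dot_act H.symm, ht, smul_dotProduct, dotProduct_smul]
    simp only [smul_eq_mul]; ring
  have hxcx : t ^ 2 * (h i ⨯₃ h (i + 2) ⬝ᵥ (φ c *ᵥ (h i ⨯₃ h (i + 2))))
      = s * (h (i + 1) ⬝ᵥ (φ (b ^ 2) *ᵥ h (i + 1))) := by
    have e1 : (φ b *ᵥ h (i + 1)) ⬝ᵥ (φ c *ᵥ (φ b *ᵥ h (i + 1)))
        = s * (h (i + 1) ⬝ᵥ (φ (b ^ 2) *ᵥ h (i + 1))) := by
      rw [dot_act H.symm, act_mul, act_mul, show b * c * b = b * b * c by ring, hbc, map_sub,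
        Matrix.sub_mulVec, ← act_mul, act_algebraMap, act_algebraMap, dotProduct_sub,
        dotProduct_smul, dotProduct_smul, H.isotropic]
      simp
    rw [← e1, ht, Matrix.mulVec_smul, smul_dotProduct, dotProduct_smul]
    simp only [smul_eq_mul]; ring
  -- `D c = D s - adj (b²)`, and the trace of the adjugate is the minor sum `2 D s`.
  have htrace : (φ c).trace = s := by
    obtain ⟨b', hb'⟩ := exists_mul_eq_one H.inj H.det
    have hD : algebraMap ℂ A ((φ b).det ^ 2) = (b ^ 2) ^ 3
        - algebraMap ℂ A (φ (b ^ 2)).trace * (b ^ 2) ^ 2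
        + algebraMap ℂ A (φ (b ^ 2)).minorSum * b ^ 2 := by
      have := cayley_hamilton_act H.inj (b ^ 2)
      rw [show (φ (b ^ 2)).det = (φ b).det ^ 2 by rw [map_pow, Matrix.det_pow]] at this
      linear_combination -this
    have hadj : b ^ 2 * (algebraMap ℂ A (φ b).det * c) = b ^ 2 * (algebraMap ℂ A ((φ b).det * s)
        - (b ^ 2 * b ^ 2 - algebraMap ℂ A (φ (b ^ 2)).trace * b ^ 2
          + algebraMap ℂ A (φ (b ^ 2)).minorSum)) := by
      simp only [map_mul, map_pow] at hD ⊢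
      linear_combination algebraMap ℂ A (φ b).det * hbc - hD
    have hadj' := congrArg (b' ^ 2 * ·) hadj
    simp only [← mul_assoc] at hadj'
    rw [show b' ^ 2 * b ^ 2 = 1 by linear_combination (b * b' + 1) * hb', one_mul, one_mul]
      at hadj'
    have htr := congrArg (fun f => (φ f).trace) hadj'
    simp only [map_sub, map_add, Algebra.algebraMap_eq_smul_one, smul_mul_assoc, one_mul,
      map_smul, map_one, Matrix.trace_sub, Matrix.trace_add, Matrix.trace_smul,
      Matrix.trace_one, Fintype.card_fin, smul_eq_mul] at htr
    rw [map_mul φ (b ^ 2), trace_mul_self, hms] at htr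
    exact mul_left_cancel₀ H.det (by push_cast at htr; linear_combination htr)
  rw [htrace] at hpair
  have hz : t ^ 2 * (2 * (h i ⬝ᵥ h (i + 2))) * (h i ⬝ᵥ (φ c *ᵥ h (i + 2))) = 0 := by
    linear_combination t ^ 2 * hpair + hxcx - s * hxx + t ^ 2 * s * hdd
  exact (mul_eq_zero.1 hz).resolve_left
    (mul_ne_zero (pow_ne_zero 2 ht0) (mul_ne_zero two_ne_zero hd))

/-- The lines `b (h (i+1))` and `a (h (i+k))` meet in `h i`, while `b (h (i+k))` and `a (h (i+1))`
meet in `h (i+k+1)`; `orthogonal_add` applies to these two intersections. -/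
theorem isConj_succ (H : IsPonceletChain φ m b h) {a a₀ c : A} {k : ℤ} {κ s t : ℂ} (hk : 2 ≤ k)
    (hkm : 2 * k < m) (ha : (φ a).det ≠ 0) (hconj : IsShiftConj φ h k a)
    (hconj₀ : IsShiftConj φ h (k - 1) a₀)
    (hab : b ^ 2 = a ^ 2 + algebraMap ℂ A κ) (hE : (φ b).det = (φ a).det + s * κ)
    (hc : a * b * c = algebraMap ℂ A s * a ^ 2 - algebraMap ℂ A (φ a).det)
    (ht : algebraMap ℂ A (φ b).det * a ^ 2 + algebraMap ℂ A (φ a).det * b ^ 2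
      = algebraMap ℂ A t * (a * b * a₀)) : IsShiftConj φ h (k + 1) c := by
  intro i
  have hκ := H.const_ne_zero hk hkm ha hconj hab
  have hn : ∀ j, φ b *ᵥ h j ≠ 0 := fun j => act_ne_zero H.det (H.ne_zero j)
  have hn' : ∀ j, φ a *ᵥ h j ≠ 0 := fun j => act_ne_zero ha (H.ne_zero j)
  have hP0 : (φ b *ᵥ h (i + 1)) ⨯₃ (φ a *ᵥ h (i + k)) ≠ 0 :=
    cross_ne_zero_of_isotropic (x := h i) (y := h (i + 2)) (z := h (i + 2 * k)) (hn _) (hn' _)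
      (H.isotropic _) (H.isotropic _) (H.isotropic _) (H.conj.apply H.symm (by omega))
      (H.conj.apply H.symm (by omega)) (hconj.apply H.symm (by omega))
      (H.cross_ne 1 (by omega) (by omega) (by omega) (by omega))
      (H.cross_ne k (by omega) (by omega) (by omega) (by omega))
      (H.cross_ne (k - 1) (by omega) (by omega) (by omega) (by omega))
  have hU0 : (φ b *ᵥ h (i + k)) ⨯₃ (φ a *ᵥ h (i + 1)) ≠ 0 :=
    cross_ne_zero_of_isotropic (x := h (i + (k + 1))) (y := h (i + k - 1)) (z := h (i + 1 - k))
      (hn _) (hn' _) (H.isotropic _) (H.isotropic _) (H.isotropic _)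
      (H.conj.apply H.symm (by omega))
      (H.conj.apply H.symm (by omega)) (hconj.apply H.symm (by omega))
      (H.cross_ne (-1) (by omega) (by omega) (by omega) (by omega))
      (H.cross_ne (-k) (by omega) (by omega) (by omega) (by omega))
      (H.cross_ne (1 - k) (by omega) (by omega) (by omega) (by omega))
  obtain ⟨p, hp⟩ := exists_cross_eq_smul (H.ne_zero i) (u := φ b *ᵥ h (i + 1))
    (v := φ a *ᵥ h (i + k)) (H.conj.apply H.symm (by omega)) (hconj.apply H.symm (by omega))
  obtain ⟨u, hu⟩ := exists_cross_eq_smul (H.ne_zero (i + (k + 1))) (u := φ b *ᵥ h (i + k))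
    (v := φ a *ᵥ h (i + 1)) (H.conj.apply H.symm (by omega)) (hconj.apply H.symm (by omega))
  have key := orthogonal_add H.inj H.symm ha H.det hab hκ hE hc ht (H.isotropic (i + 1))
    (H.isotropic (i + k)) (hconj₀.apply H.symm (by omega)) (by
      rw [hp, smul_dotProduct, dotProduct_smul, H.isotropic]; simp)
  rw [hp, hu, Matrix.mulVec_smul, smul_dotProduct, dotProduct_smul, smul_smul,
    smul_eq_mul] at key
  refine (mul_eq_zero.1 key).resolve_left (mul_ne_zero ?_ ?_)
  · rintro rfl; exact hP0 (by rw [hp, zero_smul])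
  · rintro rfl; exact hU0 (by rw [hu, zero_smul])

end IsPonceletChain

end Chain

/-! ### Conjugacy at every distance -/

namespace IsPonceletChain

variable {A : Type*} [CommRing A] [Algebra ℂ A] {φ : A →ₐ[ℂ] Matrix (Fin 3) (Fin 3) ℂ}
  {m : ℕ} {b : A} {h : ℤ → Fin 3 → ℂ}

/-- The induction carries the preceding element `a₀` and the relation recovering it from `a` and
`b`, since the addition step uses conjugacy at distance `k - 1`. -/
theorem exists_isShiftConj_aux (H : IsPonceletChain φ m b h) (k : ℕ) (hk : 2 ≤ k) :
    2 * k < m → ∃ (a a₀ : A) (κ t : ℂ), (φ a).det ≠ 0 ∧ IsShiftConj φ h k a ∧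
      IsShiftConj φ h (k - 1) a₀ ∧ b ^ 2 = a ^ 2 + algebraMap ℂ A κ ∧
      algebraMap ℂ A (φ b).det * a ^ 2 + algebraMap ℂ A (φ a).det * b ^ 2
        = algebraMap ℂ A t * (a * b * a₀) := by
  induction k, hk using Nat.le_induction with
  | base =>
    intro hm
    have hD : 2 * (φ b).det ≠ 0 := mul_ne_zero two_ne_zero H.det
    -- The slope of the tangent to the cubic at `(0, det b)`.
    set s := (φ (b ^ 2)).minorSum / (2 * (φ b).det) with hs
    have hms : (φ (b ^ 2)).minorSum = 2 * (φ b).det * s := by rw [hs, mul_div_cancel₀ _ hD]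
    obtain ⟨c, hc, hc2, ht⟩ := exists_third_point (κ := 0) (m := s)
      (n := s ^ 2 - (φ (b ^ 2)).trace) H.inj H.det H.det (by simp) (by simp) (by ring)
      (by rw [hms]; ring)
    have hconj := H.isConj_two hc hms
    refine ⟨c, b, -(s ^ 2 - (φ (b ^ 2)).trace), 0 - (s ^ 2 - (φ (b ^ 2)).trace),
      H.det_ne_zero two_pos (by exact_mod_cast hm) hconj hc2, hconj, ?_, ?_, ?_⟩
    · simpa using H.conj
    · rw [hc2, map_neg]; ring
    · rw [ht]; ring
  | succ k hk ih =>
    intro hm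
    obtain ⟨a, a₀, κ, t, ha, hconj, hconj₀, hab, ht⟩ := ih (by omega)
    have hκ := H.const_ne_zero (by exact_mod_cast hk) (by omega) ha hconj hab
    obtain ⟨s, n, hE, htr, hms⟩ := exists_slope hab hκ
    obtain ⟨c, hc, hc2, ht'⟩ := exists_third_point H.inj ha H.det hab hE htr hms
    have hconj' := H.isConj_succ (by exact_mod_cast hk) (by omega) ha hconj hconj₀ hab hE hc ht
    have hbc : c ^ 2 = b ^ 2 + algebraMap ℂ A (n - κ) := by rw [hc2, hab, map_sub]; ring
    refine ⟨c, a, κ - n, κ - n, H.det_ne_zero (by omega) (by omega) hconj' hbc, ?_, ?_, ?_, ?_⟩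
    · exact_mod_cast hconj'
    · simpa using hconj
    · rw [hbc, map_sub, map_sub]; ring
    · rw [ht']; ring

theorem exists_isShiftConj (H : IsPonceletChain φ m b h) {k : ℕ} (hk : 0 < k)
    (hm : 2 * k < m) : ∃ a : A, (φ a).det ≠ 0 ∧ IsShiftConj φ h k a := by
  rcases Nat.lt_or_ge k 2 with h2 | h2
  · obtain rfl : k = 1 := by omega
    exact ⟨b, H.det, by exact_mod_cast H.conj⟩
  · obtain ⟨a, -, -, -, ha, hconj, -⟩ := H.exists_isShiftConj_aux k h2 hm
    exact ⟨a, ha, hconj⟩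

/-- Both end points are orthogonal to `φ a *ᵥ h j`, so it is their joining line. -/
theorem exists_cross_eq (H : IsPonceletChain φ m b h) {a : A} {k : ℤ} (hk : 0 < k) (hm : k < m)
    (ha : (φ a).det ≠ 0) (hconj : IsShiftConj φ h k a) {i j l : ℤ}
    (hij : j = i + k ∧ l = j + k ∨ i = j + k ∧ j = l + k) :
    ∃ t : ℂ, t ≠ 0 ∧ h i ⨯₃ h l = t • (φ a *ᵥ h j) := by
  have hx : h i ⨯₃ h l ≠ 0 := by
    rcases hij with h1 | h1
    · exact H.cross_ne k (by omega) (by omega) (by omega) (by omega)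
    · exact H.cross_ne (-k) (by omega) (by omega) (by omega) (by omega)
  obtain ⟨t, ht⟩ := exists_eq_smul_cross (n := φ a *ᵥ h j) hx
    (hconj.apply H.symm (by omega)) (hconj.apply H.symm (by omega))
  have hn := act_ne_zero ha (H.ne_zero j)
  have ht0 : t ≠ 0 := by rintro rfl; simp [ht] at hn
  exact ⟨t⁻¹, inv_ne_zero ht0, by rw [ht, smul_smul, inv_mul_cancel₀ ht0, one_smul]⟩

end IsPonceletChain

/-! ### Square roots of invertible matrices as polynomials in the matrix -/

section SquareRoot

open Polynomial

/-- Roots are added one at a time: replacing `p` by `p + t g` turns the quotient `q` into `q + 2 t p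
+ t² g`, which must vanish at the new root. -/
theorem exists_sq_sub_X_dvd (s : Multiset ℂ) (hs : ∀ r ∈ s, r ≠ 0) :
    ∃ p : ℂ[X], (s.map fun r => X - C r).prod ∣ p ^ 2 - X := by
  induction s using Multiset.induction_on with
  | empty => exact ⟨0, by simp⟩
  | cons r s ih =>
    obtain ⟨p, q, hq⟩ := ih fun x hx => hs x (Multiset.mem_cons_of_mem hx)
    have hr := hs r (Multiset.mem_cons_self r s)
    set g := (s.map fun r => X - C r).prod
    obtain ⟨t, ht⟩ : ∃ t : ℂ, q.eval r + 2 * t * p.eval r + t ^ 2 * g.eval r = 0 := by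
      -- At a repeated root the equation for `t` is linear, solvable because `p(r)² = r ≠ 0`;
      -- otherwise it is quadratic.
      by_cases hg : g.eval r = 0
      · have hp : p.eval r ≠ 0 := by
          intro h0
          have := congrArg (eval r) hq
          simp [h0, hg] at this
          exact hr this
        exact ⟨-q.eval r / (2 * p.eval r), by rw [hg]; field_simp; ring⟩
      · obtain ⟨z, hz⟩ := IsAlgClosed.exists_pow_nat_eq
          ((p.eval r) ^ 2 - g.eval r * q.eval r) (n := 2) two_pos
        refine ⟨(z - p.eval r) / g.eval r, ?_⟩
        field_simp
        linear_combination hz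
    refine ⟨p + C t * g, ?_⟩
    have hroot : (X - C r) ∣ q + 2 * C t * p + C t ^ 2 * g := by
      rw [dvd_iff_isRoot, IsRoot.def, ← ht]
      simp
    obtain ⟨w, hw⟩ := hroot
    refine ⟨w, ?_⟩
    rw [Multiset.map_cons, Multiset.prod_cons]
    linear_combination hq + g * hw

theorem exists_aeval_sq_eq {n : Type*} [Fintype n] [DecidableEq n] (M : Matrix n n ℂ)
    (hM : M.det ≠ 0) : ∃ p : ℂ[X], aeval M p * aeval M p = M := by
  obtain ⟨p, hp⟩ := exists_sq_sub_X_dvd M.charpoly.roots (by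
    rintro r hr rfl
    have h1 := (mem_roots'.1 hr).2
    rw [IsRoot.def, Matrix.eval_charpoly] at h1
    simp [Matrix.det_neg, hM] at h1)
  rw [← (IsAlgClosed.splits M.charpoly).eq_prod_roots_of_monic M.charpoly_monic] at hp
  obtain ⟨q, hq⟩ := hp
  have := congrArg (aeval M) hq
  rw [map_mul, Matrix.aeval_self_charpoly, zero_mul, map_sub, aeval_X, map_pow, pow_two] at this
  exact ⟨p, sub_eq_zero.1 this⟩

theorem isSymm_aeval {n : Type*} [Fintype n] [DecidableEq n] {M : Matrix n n ℂ}
    (hM : M.IsSymm) (p : ℂ[X]) : (aeval M p).IsSymm := by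
  induction p using Polynomial.induction_on' with
  | add p q hp hq => rw [map_add]; exact hp.add hq
  | monomial k c =>
    rw [aeval_monomial, Algebra.algebraMap_eq_smul_one, smul_mul_assoc, one_mul]
    exact (hM.pow k).smul c

end SquareRoot

/-! ### Homogeneous coordinates -/

section Representatives

/-- `v` is a vector of homogeneous coordinates of `p`. -/
def IsRep (p : ProjPoint) (v : Fin 3 → ℂ) : Prop :=
  ∃ hv : v ≠ 0, p = Projectivization.mk ℂ v hv

theorem IsRep.eq {p q : ProjPoint} {v : Fin 3 → ℂ} (hp : IsRep p v) (hq : IsRep q v) : p = q := by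
  obtain ⟨_, rfl⟩ := hp
  obtain ⟨_, rfl⟩ := hq
  rfl

theorem isRep_rep (p : ProjPoint) : IsRep p p.rep := ⟨p.rep_nonzero, p.mk_rep.symm⟩

theorem IsRep.ne_iff {p q : ProjPoint} {v w : Fin 3 → ℂ} (hp : IsRep p v) (hq : IsRep q w) :
    p ≠ q ↔ v ⨯₃ w ≠ 0 := by
  obtain ⟨_, rfl⟩ := hp
  obtain ⟨_, rfl⟩ := hq
  exact (Projectivization.mk_eq_mk_iff_crossProduct_eq_zero _ _).not

theorem IsRep.cross {p q : ProjPoint} {v w : Fin 3 → ℂ} (hp : IsRep p v) (hq : IsRep q w)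
    (h : v ⨯₃ w ≠ 0) : IsRep (Projectivization.cross p q) (v ⨯₃ w) := by
  obtain ⟨_, rfl⟩ := hp
  obtain ⟨_, rfl⟩ := hq
  exact ⟨h, Projectivization.cross_mk_of_cross_ne_zero _ _ h⟩

theorem IsRep.orthogonal_iff {p q : ProjPoint} {v w : Fin 3 → ℂ} (hp : IsRep p v)
    (hq : IsRep q w) : p.orthogonal q ↔ v ⬝ᵥ w = 0 := by
  obtain ⟨_, rfl⟩ := hp
  obtain ⟨_, rfl⟩ := hq
  exact Projectivization.orthogonal_mk _ _

theorem IsRep.of_smul {p : ProjPoint} {v : Fin 3 → ℂ} {t : ℂ} (h : IsRep p (t • v)) :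
    IsRep p v := by
  obtain ⟨h0, rfl⟩ := h
  have hv : v ≠ 0 := by rintro rfl; simp at h0
  have ht : t ≠ 0 := by rintro rfl; simp at h0
  exact ⟨hv, (Projectivization.mk_eq_mk_iff' ℂ _ _ _ _).2 ⟨t, rfl⟩⟩

theorem IsRep.exists_smul {p : ProjPoint} {v w : Fin 3 → ℂ} (hv : IsRep p v) (hw : IsRep p w) :
    ∃ t : ℂ, v = t • w := by
  obtain ⟨_, rfl⟩ := hv
  obtain ⟨_, h⟩ := hw
  obtain ⟨t, ht⟩ := (Projectivization.mk_eq_mk_iff' ℂ _ _ _ _).1 h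
  exact ⟨t, ht.symm⟩

theorem mulVec_ne_zero_of_det {M : Matrix (Fin 3) (Fin 3) ℂ} (hM : M.det ≠ 0) {x : Fin 3 → ℂ}
    (hx : x ≠ 0) : M *ᵥ x ≠ 0 := fun h => hM (Matrix.exists_mulVec_eq_zero_iff.1 ⟨x, hx, h⟩)

/-- The effect of a projective transformation `M` on joins; `K` is the contragredient of `M`. -/
theorem IsRep.cross_mulVec {p q : ProjPoint} {u v n : Fin 3 → ℂ} {M K : Matrix (Fin 3) (Fin 3) ℂ}
    {t : ℂ} (hp : IsRep p (M *ᵥ u)) (hq : IsRep q (M *ᵥ v)) (hM : M.det ≠ 0) (hK : Mᵀ * K = 1)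
    (ht : t ≠ 0) (hn : n ≠ 0) (huv : u ⨯₃ v = t • n) :
    p ≠ q ∧ IsRep (Projectivization.cross p q) (K *ᵥ n) := by
  have hKM : K * Mᵀ = 1 := mul_eq_one_comm.1 hK
  have h1 : (M *ᵥ u) ⨯₃ (M *ᵥ v) = (M.det * t) • (K *ᵥ n) := by
    have := congrArg (K *ᵥ ·) (transpose_mulVec_cross_mulVec M u v)
    simpa only [Matrix.mulVec_mulVec, hKM, Matrix.one_mulVec, huv, Matrix.mulVec_smul, smul_smul]
      using this
  have hKdet : K.det ≠ 0 := by
    intro h0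
    have := congrArg Matrix.det hK
    rw [Matrix.det_mul, h0] at this
    simp at this
  have hne : (M *ᵥ u) ⨯₃ (M *ᵥ v) ≠ 0 := by
    rw [h1]
    exact smul_ne_zero (mul_ne_zero hM ht) (mulVec_ne_zero_of_det hKdet hn)
  refine ⟨(hp.ne_iff hq).2 hne, ?_⟩
  have := hp.cross hq hne
  rw [h1] at this
  exact this.of_smul

end Representatives

/-! ### The operations on a chain -/

namespace IsPonceletChain

variable {A : Type*} [CommRing A] [Algebra ℂ A] {φ : A →ₐ[ℂ] Matrix (Fin 3) (Fin 3) ℂ}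
  {m : ℕ} {e : A} {h : ℤ → Fin 3 → ℂ}

/-- On a polygon projectively equivalent to a shift of the chain `h`, the operation `∧_b ∨_a` acts
as a projective transformation followed by a shift of the indices. -/
theorem meetJoin_isRep (H : IsPonceletChain φ m e h) {a b : ℕ} (ha : 0 < a) (hb : 0 < b)
    (ham : 2 * a < m) (hbm : 2 * b < m) {α α' β : A} (hα : (φ α).det ≠ 0)
    (hα' : α * α' = 1) (hβ : (φ β).det ≠ 0) (haα : IsShiftConj φ h a α)
    (hbβ : IsShiftConj φ h b β) {M : Matrix (Fin 3) (Fin 3) ℂ} (hM : M.det ≠ 0) {s : ℤ}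
    {Q : ZMod m → ProjPoint} (hQ : ∀ i : ℤ, IsRep (Q i) (M *ᵥ h (2 * i + s))) :
    MeetJoinDefined b a Q ∧
      ∀ i : ℤ, IsRep (meetJoin b a Q i) ((M * φ (α' * β)) *ᵥ h (2 * i + (s + a - b))) := by
  have hMu : IsUnit M.det := isUnit_iff_ne_zero.2 hM
  have hK : Mᵀ * (M⁻¹)ᵀ = 1 := by
    rw [← Matrix.transpose_mul, Matrix.nonsing_inv_mul _ hMu, Matrix.transpose_one]
  have hjoin : ∀ i : ℤ, Q i ≠ Q (i + (a : ZMod m)) ∧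
      IsRep (joinRing a Q i) (((M⁻¹)ᵀ * φ α) *ᵥ h (2 * i + (s + a))) := by
    intro i
    have h2 := hQ (i + a)
    push_cast at h2
    obtain ⟨t, ht, hcr⟩ := H.exists_cross_eq (i := 2 * i + s) (j := 2 * i + (s + a))
      (l := 2 * (i + a) + s) (by omega) (by omega) hα haα (Or.inl ⟨by ring, by ring⟩)
    have := (hQ i).cross_mulVec h2 hM hK ht (act_ne_zero hα (H.ne_zero _)) hcr
    rwa [Matrix.mulVec_mulVec] at this
  have hdet : ((M⁻¹)ᵀ * φ α).det ≠ 0 := by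
    rw [Matrix.det_mul, Matrix.det_transpose]
    exact mul_ne_zero (Matrix.isUnit_nonsing_inv_det _ hMu).ne_zero hα
  -- Lines transform by `(M⁻¹)ᵀ * φ α`; as `φ α` is symmetric, the contragredient is `M * φ α'`.
  have hK' : ((M⁻¹)ᵀ * φ α)ᵀ * (M * φ α') = 1 := by
    rw [Matrix.transpose_mul, Matrix.transpose_transpose, (H.symm α).eq, Matrix.mul_assoc,
      ← Matrix.mul_assoc M⁻¹, Matrix.nonsing_inv_mul _ hMu, Matrix.one_mul, ← map_mul, hα',
      map_one]
  have hmeet : ∀ i : ℤ, joinRing a Q i ≠ joinRing a Q (i - (b : ZMod m)) ∧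
      IsRep (meetJoin b a Q i) ((M * φ (α' * β)) *ᵥ h (2 * i + (s + a - b))) := by
    intro i
    have h2 := (hjoin (i - b)).2
    push_cast at h2
    obtain ⟨t, ht, hcr⟩ := H.exists_cross_eq (i := 2 * i + (s + a)) (j := 2 * i + (s + a - b))
      (l := 2 * (i - b) + (s + a)) (by omega) (by omega) hβ hbβ (Or.inr ⟨by ring, by ring⟩)
    have := (hjoin i).2.cross_mulVec h2 hdet hK' ht (act_ne_zero hβ (H.ne_zero _)) hcr
    rwa [Matrix.mulVec_mulVec, Matrix.mul_assoc, ← map_mul] at this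
  refine ⟨⟨fun i => ?_, fun i => ?_⟩, fun i => (hmeet i).2⟩
  · obtain ⟨j, rfl⟩ := ZMod.intCast_surjective i
    exact (hjoin j).1
  · obtain ⟨j, rfl⟩ := ZMod.intCast_surjective i
    exact (hmeet j).1

end IsPonceletChain

/-! ### From Poncelet polygons to chains, and the theorem -/

theorem exists_symm_sqrt {G : Matrix (Fin 3) (Fin 3) ℂ} (hG : G.IsSymm) (hdet : G.det ≠ 0) :
    ∃ N : Matrix (Fin 3) (Fin 3) ℂ, N * N = G ∧ N.IsSymm ∧ N.det ≠ 0 := by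
  obtain ⟨p, hp⟩ := exists_aeval_sq_eq G hdet
  refine ⟨_, hp, isSymm_aeval hG p, fun h0 => hdet ?_⟩
  rw [← hp, Matrix.det_mul, h0, zero_mul]

theorem isSymm_dot_mulVec {N : Matrix (Fin 3) (Fin 3) ℂ} (hN : N.IsSymm) (x y : Fin 3 → ℂ) :
    (N *ᵥ x) ⬝ᵥ y = x ⬝ᵥ (N *ᵥ y) := by
  rw [Matrix.dotProduct_mulVec, ← Matrix.mulVec_transpose, hN.eq]

theorem ProjConic.isRep_polar (C : ProjConic) (p : ProjPoint) :
    IsRep (C.polar p) (C.mat *ᵥ p.rep) := by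
  refine ⟨mulVec_ne_zero_of_det C.det_ne_zero p.rep_nonzero, ?_⟩
  conv_lhs => rw [← p.mk_rep]
  rw [ProjConic.polar, Projectivization.map_mk]
  rfl

theorem ProjConic.HasPoint.rep_dot {C : ProjConic} {p : ProjPoint} (h : C.HasPoint p) :
    p.rep ⬝ᵥ (C.mat *ᵥ p.rep) = 0 :=
  ((isRep_rep p).orthogonal_iff (C.isRep_polar p)).1 h

open Polynomial in
/-- A Poncelet polygon is projectively equivalent to the even part of a Poncelet chain. -/
theorem exists_isPonceletChain {m : ℕ} {P : ZMod m → ProjPoint} (hP : IsPonceletPolygon P) :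
    ∃ (S B : Matrix (Fin 3) (Fin 3) ℂ)
      (b : ℂ[X] ⧸ RingHom.ker (aeval (R := ℂ) S)) (h : ℤ → Fin 3 → ℂ),
      IsPonceletChain (Ideal.kerLiftAlg (aeval (R := ℂ) S)) m b h ∧ B.det ≠ 0 ∧
      ∀ i : ℤ, IsRep (P i) (B *ᵥ h (2 * i)) := by
  obtain ⟨hm, hinj, C, X, hC, hX⟩ := hP
  obtain ⟨N, hN2, hNs, hNd⟩ := exists_symm_sqrt C.symm C.det_ne_zero
  have hNu : IsUnit N.det := isUnit_iff_ne_zero.2 hNd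
  have hNi : N⁻¹.IsSymm := by
    rw [Matrix.IsSymm, Matrix.transpose_nonsing_inv, hNs.eq]
  set S := N⁻¹ * X.mat * N⁻¹ with hS
  have hNSN : N * S * N = X.mat := by
    rw [hS, Matrix.mul_assoc N⁻¹, ← Matrix.mul_assoc N, Matrix.mul_nonsing_inv _ hNu,
      Matrix.one_mul, Matrix.mul_assoc, Matrix.nonsing_inv_mul _ hNu, Matrix.mul_one]
  have hSs : S.IsSymm := by
    rw [Matrix.IsSymm, hS, Matrix.transpose_mul, Matrix.transpose_mul, hNi.eq, X.symm.eq,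
      Matrix.mul_assoc]
  have hSd : S.det ≠ 0 := by
    intro h0
    apply X.det_ne_zero
    rw [← hNSN, Matrix.det_mul, Matrix.det_mul, h0, mul_zero, zero_mul]
  obtain ⟨f, hf⟩ := exists_aeval_sq_eq S hSd
  set T := aeval S f with hT
  have hTs : T.IsSymm := isSymm_aeval hSs f
  have hTd : T.det ≠ 0 := by
    intro h0; apply hSd; rw [← hf, Matrix.det_mul, h0, zero_mul]
  -- the vertices
  set p : ZMod m → Fin 3 → ℂ := fun i => N *ᵥ (P i).rep with hp
  have hpiso : ∀ i, p i ⬝ᵥ p i = 0 := by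
    intro i
    rw [hp, isSymm_dot_mulVec hNs, Matrix.mulVec_mulVec, hN2]
    exact (hC i).rep_dot
  have hpcross : ∀ i j, i ≠ j → p i ⨯₃ p j ≠ 0 := by
    intro i j hij h0
    have h1 := transpose_mulVec_cross_mulVec N (P i).rep (P j).rep
    have h2 := ((isRep_rep (P i)).ne_iff (isRep_rep (P j))).1 (hinj.ne hij)
    rw [show (N *ᵥ (P i).rep) ⨯₃ (N *ᵥ (P j).rep) = 0 from h0, Matrix.mulVec_zero] at h1
    exact smul_ne_zero hNd h2 h1.symm
  have hcast : ∀ k : ℤ, 0 < k → k < m → (k : ZMod m) ≠ 0 := by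
    intro k hk hkm h0
    have := Int.le_of_dvd hk ((ZMod.intCast_zmod_eq_zero_iff_dvd k m).1 h0)
    omega
  have h1ne : (1 : ZMod m) ≠ 0 := by simpa using hcast 1 one_pos (by omega)
  have h2ne : (1 + 1 : ZMod m) ≠ 0 := by
    have := hcast 2 two_pos (by omega)
    rwa [Int.cast_ofNat, ← one_add_one_eq_two] at this
  -- the sides
  have hside : ∀ i, ∃ g : Fin 3 → ℂ, T *ᵥ g = p i ⨯₃ p (i + 1) ∧ g ⬝ᵥ g = 0 := by
    intro i
    obtain ⟨q, hq, hqi⟩ := hX i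
    have hne := ((isRep_rep (P i)).ne_iff (isRep_rep (P (i + 1)))).1
      (hinj.ne (by simpa using h1ne))
    have hj : IsRep (joinRing 1 P i) ((P i).rep ⨯₃ (P (i + 1)).rep) := by
      have := (isRep_rep (P i)).cross (isRep_rep (P (i + 1))) hne
      simpa [joinRing, joinPts] using this
    rw [hqi] at hj
    obtain ⟨c, hc⟩ := hj.exists_smul (X.isRep_polar q)
    have h1 := transpose_mulVec_cross_mulVec N (P i).rep (P (i + 1)).rep
    rw [hc, hNs.eq, ← hNSN] at h1
    have h2 := congrArg (N⁻¹ *ᵥ ·) h1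
    simp only [Matrix.mulVec_mulVec, Matrix.mulVec_smul, smul_smul, ← Matrix.mul_assoc,
      Matrix.nonsing_inv_mul _ hNu, Matrix.one_mulVec, Matrix.one_mul] at h2
    -- In the new coordinates the side is a multiple of `S` applied to the point of tangency `N q`.
    -- Half of `S = T²` goes into `g`, whose isotropy says that `q` lies on `X`.
    refine ⟨(N.det * c) • (T *ᵥ (N *ᵥ q.rep)), ?_, ?_⟩
    · rw [Matrix.mulVec_smul, Matrix.mulVec_mulVec, Matrix.mulVec_mulVec, hf]
      exact h2.symm
    · rw [smul_dotProduct, dotProduct_smul, isSymm_dot_mulVec hTs, isSymm_dot_mulVec hNs,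
        Matrix.mulVec_mulVec, Matrix.mulVec_mulVec, Matrix.mulVec_mulVec,
        show N * T * T * N = X.mat by rw [Matrix.mul_assoc N, hf, hNSN], hq.rep_dot]
      simp
  choose g hg hgiso using hside
  have hl : ∀ i, T *ᵥ g i ≠ 0 := fun i => by
    rw [hg]; exact hpcross _ _ (by simpa using h1ne)
  have hgcross : ∀ i j, i ≠ j → g i ⨯₃ g j ≠ 0 := by
    intro i j hij h0
    obtain ⟨t, ht⟩ := exists_eq_smul_of_cross_eq_zero
      (x := g i) (fun h => hl i (by rw [h, Matrix.mulVec_zero])) h0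
    have hpar : (T *ᵥ g i) ⨯₃ (T *ᵥ g j) = 0 := by
      rw [ht, Matrix.mulVec_smul]; simp
    -- A vertex of side `j` other than the two of side `i`: `p j`, or `p (j + 1)` when the sides are
    -- consecutive, where `m ≥ 3` is needed.
    obtain ⟨k, hk1, hk2, hk3⟩ : ∃ k, p k ⬝ᵥ (T *ᵥ g j) = 0 ∧ i ≠ k ∧ i + 1 ≠ k := by
      by_cases hji : i + 1 = j
      · refine ⟨j + 1, by rw [hg]; exact dot_cross_self _ _, ?_, ?_⟩
        · rw [← hji, add_assoc]; simpa using h2ne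
        · rw [← hji]; simpa using h1ne
      · exact ⟨j, by rw [hg]; exact dot_self_cross _ _, hij, hji⟩
    refine cross_ne_zero_of_isotropic (hl i) (hl j) (hpiso i) (hpiso (i + 1)) (hpiso k) ?_ ?_ hk1
      (hpcross _ _ (by simpa using h1ne)) (hpcross _ _ hk2) (hpcross _ _ hk3) hpar
    · rw [hg]; exact dot_self_cross _ _
    · rw [hg]; exact dot_cross_self _ _
  -- Division rounds down, so `2i + 1` gives `g i`, the side between the vertices at `2i` and `2i +
  -- 2`.
  let h : ℤ → Fin 3 → ℂ := fun j => if j % 2 = 0 then p ((j / 2 : ℤ)) else g ((j / 2 : ℤ))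
  have heven : ∀ i : ℤ, h (2 * i) = p i := by
    intro i
    simp only [h]
    rw [if_pos (by omega), show 2 * i / 2 = i by omega]
  have hodd : ∀ i : ℤ, h (2 * i + 1) = g i := by
    intro i
    simp only [h]
    rw [if_neg (by omega), show (2 * i + 1) / 2 = i by omega]
  have hφ : ∀ q : ℂ[X], Ideal.kerLiftAlg (aeval (R := ℂ) S) (Ideal.Quotient.mk _ q) = aeval S q :=
    fun q => Ideal.kerLiftAlg_mk _ _
  have hshift : ∀ i k : ℤ, 0 < k → k < m → (i : ZMod m) ≠ ((i + k : ℤ) : ZMod m) := by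
    intro i k hk hkm h0
    exact hcast k hk hkm (by simpa using h0)
  refine ⟨S, N⁻¹, Ideal.Quotient.mk _ f, h, ⟨Ideal.kerLiftAlg_injective _, ?_, hm, ?_, ?_, ?_, ?_⟩,
    ?_, ?_⟩
  · intro x
    obtain ⟨q, rfl⟩ := Ideal.Quotient.mk_surjective x
    rw [hφ]; exact isSymm_aeval hSs q
  · intro j
    obtain ⟨i, rfl | rfl⟩ := Int.even_or_odd' j
    · rw [heven]; exact hpiso _
    · rw [hodd]; exact hgiso _
  · intro j k hk hkm
    obtain ⟨i, rfl | rfl⟩ := Int.even_or_odd' j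
    · rw [← mul_add, heven, heven]; exact hpcross _ _ (hshift i k hk hkm)
    · rw [show 2 * i + 1 + 2 * k = 2 * (i + k) + 1 by ring, hodd, hodd]
      exact hgcross _ _ (hshift i k hk hkm)
  · rw [hφ]; exact hTd
  · intro j
    rw [hφ]
    obtain ⟨i, rfl | rfl⟩ := Int.even_or_odd' j
    · rw [hodd, heven, hg]; exact dot_self_cross _ _
    · rw [show 2 * i + 1 + 1 = 2 * (i + 1) by ring, hodd, heven, ← isSymm_dot_mulVec hTs, hg,
        dotProduct_comm, Int.cast_add, Int.cast_one]
      exact dot_cross_self _ _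
  · exact (Matrix.isUnit_nonsing_inv_det _ hNu).ne_zero
  · intro i
    rw [heven, hp, Matrix.mulVec_mulVec, Matrix.nonsing_inv_mul _ hNu, Matrix.one_mulVec]
    exact isRep_rep _

theorem meetJoin_comm {m : ℕ} {P : ZMod m → ProjPoint} (hP : IsPonceletPolygon P) {a b c d : ℕ}
    (ha : 0 < a) (hb : 0 < b) (hc : 0 < c) (hd : 0 < d) (ham : 2 * a < m) (hbm : 2 * b < m)
    (hcm : 2 * c < m) (hdm : 2 * d < m) :
    MeetJoinDefined b a P ∧ MeetJoinDefined d c (meetJoin b a P) ∧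
      meetJoin d c (meetJoin b a P) = meetJoin b a (meetJoin d c P) := by
  obtain ⟨S, B, e, h, H, hB, hPB⟩ := exists_isPonceletChain hP
  generalize Ideal.kerLiftAlg (Polynomial.aeval (R := ℂ) S) = φ at H
  have hPB' : ∀ i : ℤ, IsRep (P i) (B *ᵥ h (2 * i + 0)) := by simpa using hPB
  obtain ⟨α, hα, hac⟩ := H.exists_isShiftConj ha ham
  obtain ⟨β, hβ, hbc⟩ := H.exists_isShiftConj hb hbm
  obtain ⟨γ, hγ, hcc⟩ := H.exists_isShiftConj hc hcm
  obtain ⟨δ, hδ, hdc⟩ := H.exists_isShiftConj hd hdm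
  obtain ⟨α', hα'⟩ := exists_mul_eq_one H.inj hα
  obtain ⟨γ', hγ'⟩ := exists_mul_eq_one H.inj hγ
  have hdet : ∀ {x x' y}, x * x' = 1 → (φ y).det ≠ 0 → (B * φ (x' * y)).det ≠ 0 := by
    intro x x' y hx hy
    have h1 : (φ x).det * (φ x').det = 1 := by
      rw [← Matrix.det_mul, ← map_mul, hx, map_one, Matrix.det_one]
    rw [map_mul, Matrix.det_mul, Matrix.det_mul]
    exact mul_ne_zero hB (mul_ne_zero (right_ne_zero_of_mul_eq_one h1) hy)
  obtain ⟨h1, r1⟩ := H.meetJoin_isRep ha hb ham hbm hα hα' hβ hac hbc hB hPB'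
  obtain ⟨-, r2⟩ := H.meetJoin_isRep hc hd hcm hdm hγ hγ' hδ hcc hdc hB hPB'
  obtain ⟨h3, r3⟩ := H.meetJoin_isRep hc hd hcm hdm hγ hγ' hδ hcc hdc (hdet hα' hβ) r1
  obtain ⟨-, r4⟩ := H.meetJoin_isRep ha hb ham hbm hα hα' hβ hac hbc (hdet hγ' hδ) r2
  refine ⟨h1, h3, funext fun i => ?_⟩
  obtain ⟨j, rfl⟩ := ZMod.intCast_surjective i
  have e3 := r3 j
  have e4 := r4 j
  rw [Matrix.mul_assoc, ← map_mul] at e3 e4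
  -- Both orders give the same total shift, and their matrices agree because `A` is commutative.
  rw [mul_comm (γ' * δ), show (0 : ℤ) + c - d + a - b = 0 + a - b + c - d by ring] at e4
  exact e3.eq e4

theorem theoremB (m : ℕ) (P : ZMod m → ProjPoint) (hP : IsPonceletPolygon P) :
    (∀ a b c d : ℕ, 0 < a → 0 < b → 0 < c → 0 < d →
      2 * a < m → 2 * b < m → 2 * c < m → 2 * d < m →
        MeetJoinDefined b a P ∧ MeetJoinDefined d c (meetJoin b a P) ∧
        MeetJoinDefined d c P ∧ MeetJoinDefined b a (meetJoin d c P) ∧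
        meetJoin d c (meetJoin b a P) = meetJoin b a (meetJoin d c P)) ∧
    (∀ s t : ℕ, 0 < s → 0 < t → 2 * s < m → 2 * t < m →
      pentagramMap s (pentagramMap t P) = pentagramMap t (pentagramMap s P)) := by
  refine ⟨fun a b c d ha hb hc hd ham hbm hcm hdm => ?_, fun s t hs ht hsm htm => ?_⟩
  · obtain ⟨h1, h2, h3⟩ := meetJoin_comm hP ha hb hc hd ham hbm hcm hdm
    obtain ⟨h4, h5, -⟩ := meetJoin_comm hP hc hd ha hb hcm hdm ham hbm
    exact ⟨h1, h2, h4, h5, h3⟩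
  · have hm : 2 * 1 < m := hP.1
    exact (meetJoin_comm hP ht one_pos hs one_pos htm hm hsm hm).2.2
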